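/- Let $R$ be a commutative noetherian ring and let $M$ be a (cochain) complex of $R$-modules, possibly unbounded, with $\inf H^*(M) > -\infty$, where $\inf H^*(M) := \inf\{i \in \mathbb{Z} \mid H^i(M) \neq 0\}$ and $\sup H^*(M) := \sup\{i \in \mathbb{Z}\mid H^i(M) \neq 0\}$ (so $\inf = \infty$ and $\sup = -\infty$ if $M$ is acyclic). If there exists an integer $n \ge \sup H^*(M)$ such that $$\operatorname{Ext}^{n+1}_{R_{\mathfrak p}}(k(\mathfrak p), M_{\mathfrak p}) = 0 \quad\text{holds for every prime ideal } \mathfrak p \text{ of } R,$$ where $k(\mathfrak p) := R_{\mathfrak p}/\mathfrak p R_{\mathfrak p}$, then the injective dimension of $M$ is at most $n$. Here $\operatorname{Ext}^{i}_{R_{\mathfrak p}}(k(\mathfrak p), M_{\mathfrak p})$ denotes the group of morphisms from $k(\mathfrak p)$ (in degree $0$) to the shifted complex $M_{\mathfrak p}[i]$ in the derived category of $R_{\mathfrak p}$-modules, and the injective dimension $\operatorname{inj\,dim}_R M$ is the infimum of the integers $m$ such that there is a quasi-isomorphism $M \to I$ where $I$ is a semi-injective complex (a complex of injective modules such that every morphism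 from an acyclic complex to $I$ is null-homotopic) with $I^i = 0$ for all $i > m$. -/

import Mathlib

open CategoryTheory

universe v u

noncomputable section

namespace CochainComplex

section Cohomology

variable {C : Type u} [Category.{v} C] [Abelian C]

/-- `inf H^*(M)`, an element of `[-∞, ∞]`; it is `∞` when `M` is acyclic. -/
def infCohomology (M : CochainComplex C ℤ) : EInt :=
  ⨅ (i : ℤ) (_ : ¬ Limits.IsZero (M.homology i)), (i : EInt)

/-- `sup H^*(M)`, an element of `[-∞, ∞]`; it is `-∞` when `M` is acyclic. -/
def supCohomology (M : CochainComplex C ℤ) : EInt :=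
  ⨆ (i : ℤ) (_ : ¬ Limits.IsZero (M.homology i)), (i : EInt)

end Cohomology

section Derived

variable {C : Type u} [Category.{v} C] [Abelian C]

attribute [local instance] HasDerivedCategory.standard

/-- `Ext^i(K, M)` for complexes `K` and `M`: the morphisms `K ⟶ M⟦i⟧` in the derived category. -/
abbrev ExtGroup (K M : CochainComplex C ℤ) (i : ℤ) : Type (max u v) :=
  ShiftedHom (DerivedCategory.Q.obj K) (DerivedCategory.Q.obj M) i

end Derived

section Injective

variable {C : Type u} [Category.{v} C] [Abelian C]

/-- A complex is semi-injective (also called DG-injective) if it consists of injective objects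
and is K-injective. -/
structure IsSemiInjective (I : CochainComplex C ℤ) : Prop where
  injective : ∀ i : ℤ, Injective (I.X i)
  isKInjective : I.IsKInjective

/-- `M` has a semi-injective resolution that vanishes in all cohomological degrees `> n`. -/
def HasInjDimLE (M : CochainComplex C ℤ) (n : ℤ) : Prop :=
  ∃ (I : CochainComplex C ℤ) (f : M ⟶ I),
    QuasiIso f ∧ I.IsSemiInjective ∧ ∀ i : ℤ, n < i → Limits.IsZero (I.X i)

/-- The injective dimension of a complex, an element of `[-∞, ∞]`. -/
def injDim (M : CochainComplex C ℤ) : EInt :=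
  ⨅ (n : ℤ) (_ : M.HasInjDimLE n), (n : EInt)

end Injective

section Modules

variable {R : Type u} [CommRing R]

/-- The localization `M_p` of a complex of `R`-modules at a prime ideal `p`,
as a complex of `R_p`-modules. -/
abbrev localizationAtPrime (M : CochainComplex (ModuleCat.{u} R) ℤ) (p : Ideal R) [p.IsPrime] :
    CochainComplex (ModuleCat.{u} (Localization.AtPrime p)) ℤ :=
  ((ModuleCat.localizedModuleFunctor.{u} p.primeCompl).mapHomologicalComplex
    (ComplexShape.up ℤ)).obj M

/-- The residue field `k(p)`, as a complex of `R_p`-modules concentrated in degree `0`. -/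
abbrev residueFieldComplex (p : Ideal R) [p.IsPrime] :
    CochainComplex (ModuleCat.{u} (Localization.AtPrime p)) ℤ :=
  (CochainComplex.singleFunctor (ModuleCat.{u} (Localization.AtPrime p)) 0).obj
    (ModuleCat.of (Localization.AtPrime p) p.ResidueField)

end Modules

end CochainComplex

end

/-!
The complex `M` has a bounded below resolution `M → I` by injective modules. Since the cohomology
of `M` vanishes above degree `n`, the truncation of `I` in degrees `≤ n`, with the module
`Z = ker (I.X n → I.X (n + 1))` in degree `n`, is quasi-isomorphic to `I`, and it consists of
injective modules as soon as `Z` is injective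
(`CochainComplex.hasInjDimLE_of_injective_cycles`). Moreover `Z → I.X n → I.X (n + 1) → ⋯` is an
injective resolution of `Z`, so that `Ext¹(-, Z) = Extⁿ⁺¹(-, M)` on modules, also after
localization at a prime `p`, because localization preserves injective modules over a noetherian
ring.

It remains to see that a module `N` with `Ext¹(k(p), N_p) = 0` for all primes `p` is injective
(`Module.Baer.of_forall_prime`). Otherwise there is an ideal `p` maximal with `Ext¹(R ⧸ p, N) ≠ 0`.
Ideals `I` with `Ext¹(R ⧸ I, N) = 0` form an Oka family, so `p` is prime. For `s ∉ p`, the sequence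
`0 → R ⧸ p → R ⧸ p → R ⧸ (p + (s)) → 0` given by multiplication by `s` and the maximality of `p`
show that `s` acts injectively on `Ext¹(R ⧸ p, N)`; hence this group embeds in its localization at
`p`, which is `Ext¹(k(p), N_p) = 0`, a contradiction.

In the formal proof these `Ext¹` groups appear as extension problems for linear maps on ideals, and
the localization as a multiplication by some `s ∉ p`.
-/

/-! ### A Baer criterion at the prime ideals -/

namespace Ideal

variable {R : Type*} [CommRing R] (N : Type*) [AddCommGroup N] [Module R N]

/-- Every linear map from the ideal `I` to `N` is multiplication by an element of `N`, that is,
extends to `R`; equivalently, `Ext¹(R ⧸ I, N) = 0`. -/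
def ExtendsTo (I : Ideal R) : Prop :=
  ∀ f : I →ₗ[R] N, ∃ y : N, ∀ (r : R) (hr : r ∈ I), f ⟨r, hr⟩ = r • y

variable {N}

/-- If `f : I → N` is multiplication by `y` on `I ∩ (a)`, in the sense that `f (r * a) = r • y`,
then `f` extends to `I + (a)` by `a ↦ y`, and hence to `R` if maps from `I + (a)` do. -/
lemma ExtendsTo.exists_of_sup_span {I : Ideal R} {a : R} (h : (I ⊔ span {a}).ExtendsTo N)
    (f : I →ₗ[R] N) (y : N) (hy : ∀ (r : R) (hr : r * a ∈ I), f ⟨r * a, hr⟩ = r • y) :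
    ∃ z : N, ∀ (r : R) (hr : r ∈ I), f ⟨r, hr⟩ = r • z := by
  have hg : ∀ c : R, c • a = 0 → RingHom.id R c • y = 0 := fun c hc ↦ by
    have h0 : c * a ∈ I := by rw [← smul_eq_mul, hc]; exact I.zero_mem
    rw [RingHom.id_apply, ← hy c h0]
    convert! f.map_zero
  let g : R →ₗ.[R] N := LinearPMap.mkSpanSingleton' a y hg
  have hfg : ∀ (x : (LinearPMap.mk I f).domain) (x' : g.domain), (x : R) = x' →
      (LinearPMap.mk I f) x = g x' := by
    rintro ⟨x, hx⟩ ⟨x', hx'⟩ rfl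
    obtain ⟨r, rfl⟩ := Submodule.mem_span_singleton.1 hx'
    exact (hy r hx).trans (LinearPMap.mkSpanSingleton'_apply a y hg r hx').symm
  obtain ⟨z, hz⟩ := h ((LinearPMap.mk I f).sup g hfg).toFun
  refine ⟨z, fun r hr ↦ ?_⟩
  rw [← hz r (Submodule.mem_sup_left hr)]
  exact ((LinearPMap.mk I f).left_le_sup g hfg).2 rfl

variable (R N) in
/-- This is the long exact sequence of
`0 → R ⧸ (I : a) → R ⧸ I → R ⧸ (I + (a)) → 0` in degree one. -/
lemma isOka_extendsTo : IsOka (ExtendsTo (R := R) N) where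
  top f := ⟨f ⟨1, trivial⟩, fun r hr ↦ by rw [← map_smul]; congr 1; ext; simp⟩
  oka {I a} h₁ h₂ f := by
    obtain ⟨y, hy⟩ := h₂ (f ∘ₗ (LinearMap.restrict (LinearMap.mulRight R a) fun r hr ↦
      mem_colon_span_singleton.1 hr))
    exact h₁.exists_of_sup_span f y fun r hr ↦ hy r (mem_colon_span_singleton.2 hr)

end Ideal

namespace Module.Baer

variable {R : Type*} [CommRing R] [IsNoetherianRing R] {N : Type*} [AddCommGroup N] [Module R N]

/-- The condition says that the class of `f` in `Ext¹(R ⧸ p, N)` dies in the localization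
at `p`. -/
lemma of_forall_prime
    (H : ∀ (p : Ideal R) [p.IsPrime] (f : p →ₗ[R] N), ∃ s ∉ p, ∃ y : N,
      ∀ (r : R) (hr : r ∈ p), s • f ⟨r, hr⟩ = r • y) : Module.Baer R N := by
  have key : ∀ I : Ideal R, I.ExtendsTo N := by
    by_contra! hne
    obtain ⟨p, hp, hmax⟩ : ∃ p : Ideal R, ¬ p.ExtendsTo N ∧
        ∀ J : Ideal R, ¬ J.ExtendsTo N → ¬ p < J :=
      set_has_maximal_iff_noetherian.2 ‹_› {I : Ideal R | ¬ I.ExtendsTo N} hne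
    have hp' : Maximal (¬ Ideal.ExtendsTo N ·) p :=
      ⟨hp, fun J hJ hle ↦ not_lt_iff_le_imp_ge.1 (hmax J hJ) hle⟩
    have : p.IsPrime := (Ideal.isOka_extendsTo R N).isPrime_of_maximal_not hp'
    refine hp fun f ↦ ?_
    -- Since `p + (s)` is larger than `p`, multiplication by `s` is injective on `Ext¹(R ⧸ p, N)`.
    obtain ⟨s, hs, y, hy⟩ := H p f
    have hlt : (p ⊔ Ideal.span {s}).ExtendsTo N :=
      of_not_not <| hp'.not_prop_of_gt (Submodule.lt_sup_iff_notMem.2 hs)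
    refine hlt.exists_of_sup_span f y fun r hr ↦ ?_
    have hrp : r ∈ p := (this.mem_or_mem hr).resolve_right hs
    rw [← hy r hrp, ← map_smul]
    congr 1
    ext
    simp [mul_comm]
  intro I f
  obtain ⟨y, hy⟩ := key I f
  exact ⟨LinearMap.toSpanSingleton R N y, fun r hr ↦ (hy r hr).symm⟩

/-- `N` is the kernel of a map `d` on an injective module `E`. The condition says that every
`R ⧸ p → E'` with values in the image of `d` becomes, after localization at `p`,
the composition of `d` with a map `R ⧸ p → E`. -/
lemma of_exact {E E' : Type*} [AddCommGroup E] [Module R E] [AddCommGroup E'] [Module R E']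
    (hE : Module.Baer R E) (i : N →ₗ[R] E) (d : E →ₗ[R] E') (hi : Function.Injective i)
    (hd : Function.Exact i d)
    (H : ∀ (p : Ideal R) [p.IsPrime] (e : E), (∀ r ∈ p, r • d e = 0) →
      ∃ s ∉ p, ∃ v : E, (∀ r ∈ p, r • v = 0) ∧ d v = s • d e) : Module.Baer R N := by
  refine of_forall_prime fun p _ f ↦ ?_
  obtain ⟨g, hg⟩ := hE p (i ∘ₗ f)
  have hge : ∀ (r : R) (hr : r ∈ p), i (f ⟨r, hr⟩) = r • g 1 := fun r hr ↦ by
    rw [← map_smul, smul_eq_mul, mul_one, hg r hr, LinearMap.comp_apply]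
  obtain ⟨s, hs, v, hv, hdv⟩ := H p (g 1) fun r hr ↦ by
    rw [← map_smul, ← hge r hr, hd.apply_apply_eq_zero]
  obtain ⟨y, hy⟩ := (hd (s • g 1 - v)).1 (by rw [map_sub, map_smul, hdv, sub_self])
  refine ⟨s, hs, y, fun r hr ↦ hi ?_⟩
  rw [map_smul, map_smul, hy, hge r hr, smul_sub, hv r hr, sub_zero, smul_comm]

end Module.Baer

/-! ### Clearing denominators -/

namespace IsLocalizedModule

variable {R : Type*} [CommRing R] (S : Submonoid R)
  {E Eₛ : Type*} [AddCommGroup E] [Module R E] [AddCommGroup Eₛ] [Module R Eₛ]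
  (ℓ : E →ₗ[R] Eₛ) [IsLocalizedModule S ℓ]

lemma exists_forall_smul_eq_zero {J : Ideal R} (hJ : J.FG) {v : E} (h : ∀ r ∈ J, r • ℓ v = 0) :
    ∃ t ∈ S, ∀ r ∈ J, r • t • v = 0 := by
  induction J, hJ using Submodule.fg_induction with
  | singleton a =>
    have ha : ℓ (a • v) = 0 := by rw [map_smul]; exact h a (Submodule.mem_span_singleton_self a)
    obtain ⟨t, ht⟩ := (eq_zero_iff S ℓ).1 ha
    refine ⟨t, t.2, fun r hr ↦ ?_⟩
    obtain ⟨c, rfl⟩ := Submodule.mem_span_singleton.1 hr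
    rw [Submonoid.smul_def] at ht
    rw [smul_assoc, smul_comm a, ht, smul_zero]
  | sup J₁ J₂ _ _ ih₁ ih₂ =>
    obtain ⟨t₁, ht₁, h₁⟩ := ih₁ fun r hr ↦ h r (Submodule.mem_sup_left hr)
    obtain ⟨t₂, ht₂, h₂⟩ := ih₂ fun r hr ↦ h r (Submodule.mem_sup_right hr)
    refine ⟨t₁ * t₂, S.mul_mem ht₁ ht₂, fun r hr ↦ ?_⟩
    obtain ⟨r₁, hr₁, r₂, hr₂, rfl⟩ := Submodule.mem_sup.1 hr
    have : (r₁ + r₂) • (t₁ * t₂) • v = t₂ • r₁ • t₁ • v + t₁ • r₂ • t₂ • v := by module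
    rw [this, h₁ r₁ hr₁, h₂ r₂ hr₂, smul_zero, smul_zero, add_zero]

variable {E' Eₛ' : Type*} [AddCommGroup E'] [Module R E'] [AddCommGroup Eₛ'] [Module R Eₛ']
  (ℓ' : E' →ₗ[R] Eₛ') [IsLocalizedModule S ℓ']

/-- Clearing denominators: if `d e` is, in the localization, the image of an element killed by
the finitely generated ideal `J`, then some multiple `s • d e` with `s ∈ S` is so already before
localizing. -/
lemma exists_smul_eq_map_of_localization {J : Ideal R} (hJ : J.FG)
    (d : E →ₗ[R] E') (dₛ : Eₛ → Eₛ') (hd : ∀ (r : R) (x : Eₛ), dₛ (r • x) = r • dₛ x)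
    (hdℓ : ∀ x, dₛ (ℓ x) = ℓ' (d x)) (e : E)
    (w : Eₛ) (hw : ∀ r ∈ J, r • w = 0) (hdw : dₛ w = ℓ' (d e)) :
    ∃ s ∈ S, ∃ v : E, (∀ r ∈ J, r • v = 0) ∧ d v = s • d e := by
  obtain ⟨⟨v, s⟩, hvs⟩ := surj S ℓ w
  replace hvs : (s : R) • w = ℓ v := hvs
  obtain ⟨t, ht, htv⟩ := exists_forall_smul_eq_zero S ℓ hJ (v := v) fun r hr ↦ by
    rw [← hvs, smul_comm, hw r hr, smul_zero]
  have hds : ℓ' (d v) = ℓ' ((s : R) • d e) := by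
    rw [← hdℓ, ← hvs, hd, hdw, map_smul]
  obtain ⟨c, hc⟩ := (eq_iff_exists S ℓ').1 hds
  rw [Submonoid.smul_def, Submonoid.smul_def] at hc
  refine ⟨t * (c * s), S.mul_mem ht (S.mul_mem c.2 s.2), (c : R) • t • v, fun r hr ↦ ?_, ?_⟩
  · rw [smul_comm, htv r hr, smul_zero]
  · rw [smul_comm, map_smul, map_smul, hc, smul_smul, smul_smul, mul_assoc]

end IsLocalizedModule

namespace CochainComplex

/-! ### Derived morphisms into K-injective complexes -/

section Derived

variable {C : Type u} [Category.{v} C] [Abelian C]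

attribute [local instance] HasDerivedCategory.standard

open HomComplex

/-- A K-injective resolution `I` of `M` computes `Ext` as cohomology of the complex of morphisms
into `I`. -/
lemma subsingleton_cohomologyClass_of_extGroup (K : CochainComplex C ℤ)
    {M I : CochainComplex C ℤ} (f : M ⟶ I) [QuasiIso f] [I.IsKInjective] (n : ℤ)
    [hK : Subsingleton (ExtGroup K M n)] : Subsingleton (CohomologyClass K I n) := by
  have : Localization.HasSmallLocalizedShiftedHom.{max u v}
      (HomologicalComplex.quasiIso C (.up ℤ)) ℤ K I :=
    (Localization.hasSmallLocalizedShiftedHom_iff _ ℤ DerivedCategory.Q K I).2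
      fun _ _ ↦ inferInstance
  have : Subsingleton (ExtGroup K I n) :=
    ((Iso.refl (DerivedCategory.Q.obj K)).homCongr
      ((CategoryTheory.shiftFunctor _ n).mapIso (asIso (DerivedCategory.Q.map f)).symm)).subsingleton
  exact ((CohomologyClass.equivOfIsKInjective.{max u v} (K := K) (L := I) (n := n)).trans
    (Localization.SmallShiftedHom.equiv _ DerivedCategory.Q)).subsingleton

/-- If `Extⁿ⁺¹(X, M) = 0`, then every morphism from `X` to the cocycles of a K-injective resolution
of `M` in degree `n + 1` lifts along the differential. -/
lemma exists_comp_d_eq_of_extGroup {X : C} {M I : CochainComplex C ℤ} (f : M ⟶ I) [QuasiIso f]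
    [I.IsKInjective] {n : ℤ}
    [Subsingleton (ExtGroup ((singleFunctor C 0).obj X) M (n + 1))]
    (g : X ⟶ I.X (n + 1)) (hg : g ≫ I.d (n + 1) (n + 2) = 0) :
    ∃ h : X ⟶ I.X n, h ≫ I.d n (n + 1) = g := by
  have := subsingleton_cohomologyClass_of_extGroup ((singleFunctor C 0).obj X) f (n + 1)
  refine (Cocycle.fromSingleMk_mem_coboundaries_iff (p := 0) g (zero_add _) (n + 2) (by lia) hg n
    rfl).1 ?_
  rw [← CohomologyClass.mk_eq_zero_iff]
  exact Subsingleton.elim _ _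

end Derived

/-! ### Injective dimension and truncation -/

section InjDim

variable {C : Type u} [Category.{v} C] [Abelian C]

/-- The truncation of `I` in degrees `≤ n` is then a bounded below complex of injectives, so that its
inclusion into `I` is a homotopy equivalence; a homotopy inverse, preceded by `f`, resolves `M`. -/
lemma hasInjDimLE_of_injective_cycles {M I : CochainComplex C ℤ} (f : M ⟶ I) [QuasiIso f]
    (a n : ℤ) [I.IsStrictlyGE a] [I.IsLE n] (hI : ∀ i, Injective (I.X i))
    (hn : Injective (I.cycles n)) : M.HasInjDimLE n := by
  have hJ : ∀ i, Injective ((I.truncLE n).X i) := fun i ↦ by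
    obtain h | rfl | h := lt_trichotomy i n
    · exact Injective.of_iso (I.truncLEXIso n i h).symm (hI i)
    · exact Injective.of_iso (I.truncLEXIsoCycles i).symm hn
    · exact (isZero_of_isStrictlyLE _ n _ h).injective
  have : (I.truncLE n).IsStrictlyGE a := inferInstance
  have : I.IsKInjective := isKInjective_of_injective I a
  have hK : (I.truncLE n).IsKInjective := isKInjective_of_injective _ a
  obtain ⟨e, he⟩ := (IsKInjective.quasiIso_iff (I.ιTruncLE n)).1 inferInstance
  have : QuasiIso e.inv := e.symm.quasiIso_hom
  exact ⟨I.truncLE n, f ≫ e.inv, inferInstance, ⟨hJ, hK⟩,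
    fun i hi ↦ isZero_of_isStrictlyLE _ n i hi⟩

variable (M : CochainComplex C ℤ)

lemma isLE_of_supCohomology_le {n : ℤ} (h : M.supCohomology ≤ (n : EInt)) : M.IsLE n := by
  rw [isLE_iff]
  intro i hi
  rw [HomologicalComplex.exactAt_iff_isZero_homology]
  by_contra hne
  have := (le_iSup₂ (f := fun (i : ℤ) (_ : ¬ Limits.IsZero (M.homology i)) ↦ (i : EInt))
    i hne).trans h
  rw [WithBotTop.coe_le_coe] at this
  lia

lemma isGE_of_le_infCohomology {a : ℤ} (h : (a : EInt) ≤ M.infCohomology) : M.IsGE a := by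
  rw [isGE_iff]
  intro i hi
  rw [HomologicalComplex.exactAt_iff_isZero_homology]
  by_contra hne
  have := h.trans (iInf₂_le (f := fun (i : ℤ) (_ : ¬ Limits.IsZero (M.homology i)) ↦ (i : EInt))
    i hne)
  rw [WithBotTop.coe_le_coe] at this
  lia

lemma exists_isGE_of_bot_lt_infCohomology (h : ⊥ < M.infCohomology) : ∃ a : ℤ, M.IsGE a := by
  suffices ∃ a : ℤ, (a : EInt) ≤ M.infCohomology from
    this.imp fun _ ↦ M.isGE_of_le_infCohomology
  generalize M.infCohomology = x at h
  induction x using WithBotTop.rec with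
  | bot => exact absurd h (lt_irrefl _)
  | coe a => exact ⟨a, le_rfl⟩
  | top => exact ⟨0, le_top⟩

lemma exists_injective_resolution [EnoughInjectives C] (a : ℤ) [M.IsGE a] :
    ∃ (I : CochainComplex C ℤ) (f : M ⟶ I), QuasiIso f ∧ I.IsStrictlyGE a ∧
      ∀ i, Injective (I.X i) := by
  obtain ⟨I, f, _, hI, hI'⟩ := Plus.modelCategoryQuillen.exists_quasiIso_injective (M.truncGE a) a
  exact ⟨I, M.πTruncGE a ≫ f, inferInstance, hI', hI⟩

end InjDim

/-! ### Localized injective resolutions -/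

section Modules

variable {R : Type u} [CommRing R]

/-- The vanishing of `Ext` over `R_p` yields, after clearing denominators, the criterion of
`Module.Baer.of_exact` for the cocycles of degree `n` in an injective resolution `I` of `M`. -/
lemma exists_smul_of_localization [IsNoetherianRing R] {M I : CochainComplex (ModuleCat.{u} R) ℤ}
    (f : M ⟶ I) [QuasiIso f] (a : ℤ) [I.IsStrictlyGE a] (hI : ∀ i, Injective (I.X i)) (n : ℤ)
    (p : Ideal R) [p.IsPrime]
    [hExt : Subsingleton (ExtGroup (residueFieldComplex p) (M.localizationAtPrime p) (n + 1))]
    (e : I.X n) (he : ∀ r ∈ p, r • I.d n (n + 1) e = 0) :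
    ∃ s ∉ p, ∃ v : I.X n, (∀ r ∈ p, r • v = 0) ∧ I.d n (n + 1) v = s • I.d n (n + 1) e := by
  let F := ModuleCat.localizedModuleFunctor.{u} p.primeCompl
  let I' := I.localizationAtPrime p
  let f' : M.localizationAtPrime p ⟶ I' := (F.mapHomologicalComplex (ComplexShape.up ℤ)).map f
  have : QuasiIso f' := inferInstance
  have hI' : ∀ i, Injective (I'.X i) := fun i ↦ F.injective_obj (I.X i)
  have : I'.IsStrictlyGE a := inferInstance
  have : I'.IsKInjective := isKInjective_of_injective _ a
  let ℓ (i : ℤ) : I.X i →ₗ[R] (I.X i).localizedModule p.primeCompl :=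
    (I.X i).localizedModuleMkLinearMap p.primeCompl
  let d' (i j : ℤ) : (I.X i).localizedModule p.primeCompl →ₗ[Localization.AtPrime p]
    (I.X j).localizedModule p.primeCompl := (I'.d i j).hom
  have hdℓ (i j : ℤ) (x : I.X i) : d' i j (ℓ i x) = ℓ j (I.d i j x) :=
    IsLocalizedModule.map_apply p.primeCompl (ℓ i) (ℓ j) (I.d i j).hom x
  -- The cocycle in question is the map `k(p) → I'.X (n + 1)` sending `1` to `ℓ (d e)`.
  have hker : IsLocalRing.maximalIdeal (Localization.AtPrime p) ≤
      LinearMap.ker (LinearMap.toSpanSingleton (Localization.AtPrime p)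
        ((I.X (n + 1)).localizedModule p.primeCompl) (ℓ (n + 1) (I.d n (n + 1) e))) := by
    rw [← Localization.AtPrime.map_eq_maximalIdeal, Ideal.map_le_iff_le_comap]
    intro r hr
    rw [Ideal.mem_comap, LinearMap.mem_ker, LinearMap.toSpanSingleton_apply, algebraMap_smul,
      ← map_smul, he r hr, map_zero]
  let g₀ : p.ResidueField →ₗ[Localization.AtPrime p]
      (I.X (n + 1)).localizedModule p.primeCompl := Submodule.liftQ _ _ hker
  have hg₀ (x : Localization.AtPrime p) :
      g₀ (IsLocalRing.residue _ x) = x • ℓ (n + 1) (I.d n (n + 1) e) := rfl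
  let g : ModuleCat.of (Localization.AtPrime p) p.ResidueField ⟶ I'.X (n + 1) := ModuleCat.ofHom g₀
  have hg : g ≫ I'.d (n + 1) (n + 2) = 0 := by
    ext y
    obtain ⟨x, rfl⟩ := IsLocalRing.residue_surjective y
    change d' (n + 1) (n + 2) (x • ℓ (n + 1) (I.d n (n + 1) e)) = 0
    rw [map_smul, hdℓ, ← ConcreteCategory.comp_apply, I.d_comp_d]
    simp
  obtain ⟨h, hh⟩ := exists_comp_d_eq_of_extGroup f' g hg
  let h₀ : p.ResidueField →ₗ[Localization.AtPrime p]
    (I.X n).localizedModule p.primeCompl := h.hom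
  refine IsLocalizedModule.exists_smul_eq_map_of_localization p.primeCompl (ℓ n) (ℓ (n + 1))
    (IsNoetherian.noetherian p) (I.d n (n + 1)).hom (d' n (n + 1)) (fun r x ↦ ?_)
    (hdℓ n (n + 1)) e (h₀ 1) (fun r hr ↦ ?_) ?_
  · rw [← algebraMap_smul (Localization.AtPrime p) r x, map_smul, algebraMap_smul]
  · have hr' : algebraMap R (Localization.AtPrime p) r ∈ IsLocalRing.maximalIdeal _ := by
      rw [← Localization.AtPrime.map_eq_maximalIdeal]
      exact Ideal.mem_map_of_mem _ hr
    rw [← algebraMap_smul (Localization.AtPrime p) r, ← map_smul, Algebra.smul_def, mul_one,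
      IsLocalRing.ResidueField.algebraMap_eq, (IsLocalRing.residue_eq_zero_iff _).2 hr', map_zero]
  · have := congr($hh (1 : p.ResidueField))
    rw [ConcreteCategory.comp_apply] at this
    refine this.trans ?_
    rw [← map_one (IsLocalRing.residue (Localization.AtPrime p))]
    exact (hg₀ 1).trans (one_smul _ _)

end Modules
end CochainComplex

/-! ### Injective dimension detected at the residue fields -/

theorem mainTheorem7 {R : Type u} [CommRing R] [IsNoetherianRing R]
    (M : CochainComplex (ModuleCat.{u} R) ℤ)
    (hM : ⊥ < M.infCohomology)
    (n : ℤ)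
    (hn : M.supCohomology ≤ (n : EInt))
    (hExt : ∀ (p : Ideal R) [p.IsPrime],
      Subsingleton (CochainComplex.ExtGroup (CochainComplex.residueFieldComplex p)
        (M.localizationAtPrime p) (n + 1))) :
    M.injDim ≤ (n : EInt) := by
  obtain ⟨a, _⟩ := M.exists_isGE_of_bot_lt_infCohomology hM
  obtain ⟨I, f, _, _, hI⟩ := M.exists_injective_resolution a
  have := M.isLE_of_supCohomology_le hn
  have : I.IsLE n := by
    rw [CochainComplex.isLE_iff]
    intro i hi
    exact (exactAt_iff_of_quasiIsoAt f i).1 (M.exactAt_of_isLE n i hi)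
  -- The cocycles of degree `n` in `I` form the kernel of a map on the injective module `I.X n`.
  refine iInf₂_le n (CochainComplex.hasInjDimLE_of_injective_cycles f a n hI ?_)
  have hE : Module.Baer R (I.X n) := by
    rw [Module.Baer.iff_injective]
    exact (Module.injective_iff_injective_object R (I.X n)).2 (hI n)
  refine (Module.injective_iff_injective_object R (I.cycles n)).1 (Module.Baer.injective ?_)
  refine hE.of_exact (I.iCycles n).hom (I.d n (n + 1)).hom
    ((ModuleCat.mono_iff_injective _).1 inferInstance) ?_ fun p _ e he ↦
      CochainComplex.exists_smul_of_localization f a hI n p e he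
  exact (ShortComplex.ShortExact.moduleCat_exact_iff_function_exact
    (ShortComplex.mk (I.iCycles n) (I.d n (n + 1)) (I.iCycles_d n (n + 1)))).1
    (ShortComplex.exact_of_f_is_kernel _ (I.cyclesIsKernel n (n + 1) (by simp)))
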